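/- Let $\zeta^{\ast}(s)=\pi^{-s/2}\,\Gamma(s/2)\,\zeta(s)$ denote the completed Riemann zeta function, a meromorphic function on $\mathbb{C}$. For each fixed real number $T\ge 1$, the function $$I(T,s) = -\zeta^{\ast}(2s)\,\frac{T^{s-1}}{s-1} + \zeta^{\ast}(2-2s)\,\frac{T^{-s}}{s}$$ is meromorphic in $s$ on $\mathbb{C}$, and all of its zeros lie on the line $\operatorname{Re}(s)=\tfrac12$. (Zeros are zeros of the meromorphic function: removable singularities are filled in, and poles are not zeros.) -/

import Mathlib

noncomputable section

/-- The function `I(T, s) = -ζ*(2s) T^(s-1) / (s-1) + ζ*(2-2s) T^(-s) / s`, where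
`ζ*(s) = π^(-s/2) Γ(s/2) ζ(s)` is Mathlib's `completedRiemannZeta`. It is to be read as a
meromorphic function of `s`: the values that Lean assigns at the isolated points
`s = 0, 1/2, 1`, where one of the two terms is singular, have no meaning. -/
def truncI (T : ℝ) (s : ℂ) : ℂ :=
  -completedRiemannZeta (2 * s) * ((T : ℂ) ^ (s - 1) / (s - 1))
    + completedRiemannZeta (2 - 2 * s) * ((T : ℂ) ^ (-s) / s)

/-- `z` is a zero of the meromorphic function `f`: its order of vanishing there is positive.
The order depends only on `f` on a punctured neighbourhood of `z`, so that removable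
singularities are filled in, poles are not zeros, and an `f` vanishing near `z` has a zero. -/
def IsMeromorphicZero (f : ℂ → ℂ) (z : ℂ) : Prop :=
  MeromorphicAt f z ∧ 0 < meromorphicOrderAt f z

/-- Away from the poles of the Gamma factor, `completedRiemannZeta` is `π^(-s/2) Γ(s/2) ζ(s)`. -/
theorem completedRiemannZeta_eq_pi_gamma_zeta (s : ℂ) (hs : ∀ n : ℕ, s ≠ -(2 * n)) :
    completedRiemannZeta s =
      (Real.pi : ℂ) ^ (-s / 2) * Complex.Gamma (s / 2) * riemannZeta s := by
  have h0 : s ≠ 0 := by simpa using hs 0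
  have hG : Complex.Gammaℝ s ≠ 0 := by
    rw [Ne, Complex.Gammaℝ_eq_zero_iff]
    rintro ⟨n, hn⟩
    exact hs n hn
  rw [riemannZeta_def_of_ne_zero h0, ← Complex.Gammaℝ_def, mul_div_cancel₀ _ hG]

end

/-!
Put `ξ(s) = s (s - 1) ζ*(s)`, an entire function with `ξ(1 - s) = ξ(s)`, real on the real axis.
Clearing denominators (`mul_truncI_eq`),

  `2 s (s - 1) (2 s - 1) I(T, s) = ξ(2 - 2s) T^(-s) - ξ(2s) T^(s - 1)`,

so at a zero of `I(T, ·)` the two terms on the right have equal modulus. Off the line `re s = 1/2`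
this is impossible: with `z = 2s - 1` one has `ξ(2 - 2s) = ξ(z)` and `ξ(2s) = ξ(z + 1)`, and
`norm_entireXi_lt` says that `|ξ(z)| < |ξ(z + 1)|` for `0 < re z`, while `T ≥ 1` makes the powers of
`T` compare the same way. The case `re s < 1/2` is symmetric.

The inequality for `ξ` is usually read off from its Hadamard product. Here it comes from the maximum
principle for `Q(z) = ξ(z) / ξ(z + 1)` on the right half-plane. `Q` is holomorphic on
`0 ≤ re z` as `ζ` has no zeros in `1 ≤ re s`, and `|Q| = 1` on `re z = 0`. The denominator can be
controlled by elementary means only up to a power of `re z`: the factorisation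

  `Q(z) = ζ₁(z) B(z / 2, 1 / 2) / ((z + 1) ζ(z + 1))`, with `ζ₁(z) = (z - 1) ζ(z)`,

gives `|Q(z)| ≤ 2 (1 + 1 / re z)³ (1 + |z|)²` (`norm_entireXi_div_le`). The version of the
Phragmén–Lindelöf principle in `norm_le_one_of_boundary_growth` allows for such a blow-up at the
boundary and yields `|Q| ≤ 1`; equality is excluded by `Q(1) = 3 / π < 1`.
-/

open Complex

/-! ### A maximum principle in the right half-plane -/

/-- A Phragmén–Lindelöf principle that tolerates a blow-up of order `(re z)⁻ᵏ` of the a priori bound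
at the boundary line. On the half-disc of radius `R` the maximum principle is applied to
`f(w) (1 + w² / R²)ᵏ / (1 + εw)ᵐ⁺¹`. On the arc `|1 + w² / R²| = 2 re w / R`, so the `k`-th power
cancels the blow-up; the denominator beats the growth of `f` as `R → ∞`, and then `ε → 0`. -/
theorem norm_le_one_of_boundary_growth {f : ℂ → ℂ} {C : ℝ} {k m : ℕ}
    (hd : DifferentiableOn ℂ f {z | 0 ≤ z.re}) (hC : 0 ≤ C)
    (hb : ∀ z : ℂ, z.re = 0 → ‖f z‖ ≤ 1)
    (hg : ∀ z : ℂ, 0 < z.re → ‖f z‖ ≤ C * (1 + 1 / z.re) ^ k * (1 + ‖z‖) ^ m)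
    {z : ℂ} (hz : 0 < z.re) : ‖f z‖ ≤ 1 := by
  have one_le_norm : ∀ (ε : ℝ), 0 < ε → ∀ w : ℂ, 0 ≤ w.re →
      1 ≤ ‖1 + ε * w‖ ∧ ε * ‖w‖ ≤ ‖1 + ε * w‖ := by
    intro ε hε w hw
    have h1 : 0 ≤ ε * w.re := by positivity
    constructor
    · refine le_trans ?_ (re_le_norm _)
      simpa using h1
    · rw [← abs_of_pos hε, ← Real.norm_eq_abs, ← norm_real, ← norm_mul, norm_real, Real.norm_eq_abs,
        abs_of_pos hε, norm_def, norm_def]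
      apply Real.sqrt_le_sqrt
      simp only [normSq_apply, add_re, add_im, mul_re, mul_im, ofReal_re, ofReal_im, one_re, one_im]
      nlinarith
  have key : ∀ ε : ℝ, 0 < ε → ∀ R : ℝ, 1 ≤ R → ‖z‖ < R →
      C * 4 ^ k * 2 ^ m / ε ^ (m + 1) ≤ R →
      ‖f z‖ * ‖1 + z ^ 2 / (R : ℂ) ^ 2‖ ^ k ≤ ‖1 + ε * z‖ ^ (m + 1) := by
    intro ε hε R hR hzR hRC
    have hR0 : 0 < R := by linarith
    have hRc : (R : ℂ) ≠ 0 := by exact_mod_cast hR0.ne'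
    set P : ℂ → ℂ := fun w => f w * (1 + w ^ 2 / (R : ℂ) ^ 2) ^ k / (1 + ε * w) ^ (m + 1) with hP
    set U : Set ℂ := Metric.ball 0 R ∩ {w | 0 < w.re} with hU
    have hopen : IsOpen {w : ℂ | 0 < w.re} := isOpen_lt continuous_const continuous_re
    have hne : ∀ w : ℂ, 0 ≤ w.re → (1 + ε * w : ℂ) ≠ 0 := fun w hw h => by
      have := (one_le_norm ε hε w hw).1
      rw [h, norm_zero] at this
      linarith
    have hclos : closure U ⊆ {w : ℂ | 0 ≤ w.re} :=
      closure_minimal (fun w hw => (le_of_lt hw.2 : (0 : ℝ) ≤ w.re))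
        (isClosed_le continuous_const continuous_re)
    have hPd : DiffContOnCl ℂ P U := by
      refine DifferentiableOn.diffContOnCl ?_
      refine DifferentiableOn.mono ?_ hclos
      refine ((hd.mul (by fun_prop)).div (by fun_prop) ?_)
      intro w hw
      exact pow_ne_zero _ (hne w hw)
    have hfront : ∀ w ∈ frontier U, ‖P w‖ ≤ 1 := by
      intro w hw
      have hre : 0 ≤ w.re := hclos hw.1
      have hnw : ‖w‖ ≤ R := by
        have : w ∈ closure (Metric.ball (0 : ℂ) R) := closure_mono Set.inter_subset_left hw.1
        simpa using Metric.closure_ball_subset_closedBall this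
      obtain ⟨h1, h2⟩ := one_le_norm ε hε w hre
      have hpos : 0 < ‖1 + ε * w‖ ^ (m + 1) := by positivity
      simp only [hP, norm_div, norm_mul, norm_pow]
      rw [div_le_one hpos]
      rcases hre.eq_or_lt with h0 | h0
      · have hA : ‖1 + w ^ 2 / (R : ℂ) ^ 2‖ ≤ 1 := by
          have hwI : w = w.im * I := by
            apply Complex.ext <;> simp [← h0]
          have hsq : w.im ^ 2 ≤ R ^ 2 := by
            have := abs_im_le_norm w
            exact sq_le_sq' (by linarith [neg_abs_le w.im]) (by linarith [le_abs_self w.im])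
          have : (1 + w ^ 2 / (R : ℂ) ^ 2) = ((1 - w.im ^ 2 / R ^ 2 : ℝ) : ℂ) := by
            rw [hwI]; simp [mul_pow]; ring
          rw [this, norm_real, Real.norm_eq_abs, abs_le]
          have : w.im ^ 2 / R ^ 2 ≤ 1 := by rw [div_le_one (by positivity)]; exact hsq
          have : 0 ≤ w.im ^ 2 / R ^ 2 := by positivity
          constructor <;> linarith
        calc _ ≤ 1 * 1 ^ k := mul_le_mul (hb w h0.symm) (pow_le_pow_left₀ (norm_nonneg _) hA k)
              (by positivity) zero_le_one
          _ = 1 := by rw [one_pow, mul_one]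
          _ ≤ _ := one_le_pow₀ h1
      · have hwR : ‖w‖ = R := by
          refine le_antisymm hnw (not_lt.1 fun hlt => ?_)
          have hmem : w ∈ U := ⟨by simpa using hlt, h0⟩
          have hUo : IsOpen U := Metric.isOpen_ball.inter hopen
          rw [hUo.frontier_eq] at hw
          exact hw.2 hmem
        -- On the arc, `R² = w * conj w`, hence `1 + w² / R² = w (conj w + w) / R²`.
        have hA : ‖1 + w ^ 2 / (R : ℂ) ^ 2‖ = 2 * w.re / R := by
          have hconj : (R : ℂ) ^ 2 = w * (starRingEnd ℂ) w := by
            rw [mul_conj, normSq_eq_norm_sq, hwR]; push_cast; rfl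
          have : (1 + w ^ 2 / (R : ℂ) ^ 2) = w * ((2 * w.re : ℝ) : ℂ) / (R : ℂ) ^ 2 := by
            field_simp
            rw [hconj, ← add_conj]; ring
          rw [this, norm_div, norm_mul, norm_pow, norm_real, norm_real, hwR, Real.norm_eq_abs,
            Real.norm_eq_abs, abs_of_pos (by positivity : 0 < 2 * w.re), abs_of_pos hR0]
          field_simp
        have hB : (1 + 1 / w.re) * (2 * w.re / R) ≤ 4 := by
          have hxR : w.re ≤ R := hwR ▸ re_le_norm w
          have : (1 + 1 / w.re) * (2 * w.re / R) = 2 * (w.re + 1) / R := by field_simp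
          rw [this, div_le_iff₀ hR0]; linarith
        have hB0 : 0 ≤ (1 + 1 / w.re) * (2 * w.re / R) := by positivity
        calc _ ≤ (C * (1 + 1 / w.re) ^ k * (1 + ‖w‖) ^ m) * (2 * w.re / R) ^ k := by
                rw [hA]; gcongr; exact hg w h0
          _ = C * ((1 + 1 / w.re) * (2 * w.re / R)) ^ k * (1 + R) ^ m := by
                rw [hwR, mul_pow]; ring
          _ ≤ C * 4 ^ k * (2 * R) ^ m := by gcongr; linarith
          _ = (C * 4 ^ k * 2 ^ m / ε ^ (m + 1)) * (ε ^ (m + 1) * R ^ m) := by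
                rw [mul_pow]; field_simp
          _ ≤ R * (ε ^ (m + 1) * R ^ m) := by gcongr
          _ = (ε * ‖w‖) ^ (m + 1) := by rw [hwR]; ring
          _ ≤ _ := by gcongr
    have hbdd : Bornology.IsBounded U := Metric.isBounded_ball.subset Set.inter_subset_left
    have hzU : z ∈ U := ⟨by simpa using hzR, hz⟩
    have := norm_le_of_forall_mem_frontier_norm_le hbdd hPd hfront (subset_closure hzU)
    simp only [hP, norm_div, norm_mul, norm_pow] at this
    rwa [div_le_one] at this
    have := (one_le_norm ε hε z hz.le).1
    positivity
  have key2 : ∀ ε : ℝ, 0 < ε → ‖f z‖ ≤ ‖1 + ε * z‖ ^ (m + 1) := by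
    intro ε hε
    have ht : Filter.Tendsto (fun R : ℝ => ‖f z‖ * ‖1 + z ^ 2 / (R : ℂ) ^ 2‖ ^ k) Filter.atTop
        (nhds (‖f z‖ * ‖(1 : ℂ) + 0‖ ^ k)) := by
      refine ((tendsto_const_nhds.add ?_).norm.pow k).const_mul _
      rw [tendsto_zero_iff_norm_tendsto_zero]
      have : Filter.Tendsto (fun R : ℝ => ‖z‖ ^ 2 / R ^ 2) Filter.atTop (nhds 0) :=
        tendsto_const_nhds.div_atTop (Filter.tendsto_pow_atTop two_ne_zero)
      refine this.congr fun R => ?_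
      simp
    simp only [add_zero, norm_one, one_pow, mul_one] at ht
    refine le_of_tendsto ht ?_
    filter_upwards [Filter.eventually_ge_atTop 1, Filter.eventually_gt_atTop ‖z‖,
      Filter.eventually_ge_atTop (C * 4 ^ k * 2 ^ m / ε ^ (m + 1))] with R h1 h2 h3
    exact key ε hε R h1 h2 h3
  have ht : Filter.Tendsto (fun ε : ℝ => ‖1 + ε * z‖ ^ (m + 1)) (nhdsWithin 0 (Set.Ioi 0))
      (nhds (‖1 + ((0 : ℝ) : ℂ) * z‖ ^ (m + 1))) :=
    (Continuous.tendsto (by fun_prop) _).mono_left nhdsWithin_le_nhds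
  have h := ge_of_tendsto ht (Filter.eventually_of_mem self_mem_nhdsWithin key2)
  simpa using h

/-! ### Bounds for zeta and beta in half-planes -/

theorem tsum_one_div_nat_add_one_rpow_le {s : ℝ} (hs : 1 < s) :
    ∑' n : ℕ, 1 / ((n : ℝ) + 1) ^ s ≤ 1 + 1 / (s - 1) := by
  have h := ZetaAsymptotics.zeta_limit_aux1 hs
  have h0 : 0 ≤ ZetaAsymptotics.termTSum s :=
    tsum_nonneg fun n => ZetaAsymptotics.term_nonneg _ _
  nlinarith

theorem summable_one_div_nat_add_one_rpow {s : ℝ} (hs : 1 < s) :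
    Summable fun n : ℕ => 1 / ((n : ℝ) + 1) ^ s := by
  exact_mod_cast (summable_nat_add_iff 1).mpr (Real.summable_one_div_nat_rpow.mpr hs)

open scoped ArithmeticFunction.Moebius in
/-- The Möbius series for `1 / ζ(s)` is dominated by the series of `ζ(re s)`. -/
theorem norm_inv_riemannZeta_le {s : ℂ} (hs : 1 < s.re) :
    ‖(riemannZeta s)⁻¹‖ ≤ 1 + 1 / (s.re - 1) := by
  have h := ArithmeticFunction.LSeries_zeta_mul_Lseries_moebius hs
  rw [ArithmeticFunction.LSeries_zeta_eq_riemannZeta hs] at h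
  rw [inv_eq_of_mul_eq_one_right h]
  refine le_trans ?_ (tsum_one_div_nat_add_one_rpow_le hs)
  rw [LSeries, ((ArithmeticFunction.LSeriesSummable_moebius_iff.2 hs)).tsum_eq_zero_add]
  simp only [LSeries.term_zero, zero_add]
  refine tsum_of_norm_bounded (summable_one_div_nat_add_one_rpow hs).hasSum fun n => ?_
  rw [LSeries.term_of_ne_zero (by omega), norm_div, norm_natCast_cpow_of_pos (by omega)]
  push_cast
  gcongr
  have := ArithmeticFunction.abs_moebius_le_one (n := n + 1)
  rw [norm_intCast]
  exact_mod_cast this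

theorem riemannZeta₁_eq_sub_one_mul {s : ℂ} (hs : s ≠ 1) :
    riemannZeta₁ s = (s - 1) * riemannZeta s := by
  rw [riemannZeta_eq_inv_sub_mul hs, mul_inv_cancel_left₀ (sub_ne_zero.2 hs)]

/-- With `a = n + 1`, the quantity estimated is `s - 1` times the difference between `a ^ (-s)` and
the integral of `x ^ (-s)` over `[a, a + 1]`; in this form it is entire in `s`. -/
theorem norm_sub_cpow_increment_le (s : ℂ) (hs : 0 < s.re) (n : ℕ) :
    ‖(s - 1) * ((n : ℂ) + 1) ^ (-s) + (((n : ℂ) + 1 + 1) ^ (1 - s) - ((n : ℂ) + 1) ^ (1 - s))‖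
      ≤ ‖s‖ * ‖s - 1‖ * (1 / ((n : ℝ) + 1) ^ (s.re + 1)) := by
  set a : ℝ := (n : ℝ) + 1 with ha
  have ha0 : 0 < a := by positivity
  have hder : ∀ (c : ℂ) (x : ℝ), 0 < x →
      HasDerivAt (fun y : ℝ => (y : ℂ) ^ c) (c * (x : ℂ) ^ (c - 1)) x := by
    intro c x hx
    have h1 : HasDerivAt (fun y : ℂ => y ^ c) (c * (x : ℂ) ^ (c - 1) * 1) (x : ℂ) :=
      (hasDerivAt_id (x : ℂ)).cpow_const (by simp [slitPlane, hx])
    simpa using h1.comp_ofReal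
  have h1 : ∀ x ∈ Set.Icc a (a + 1),
      ‖(x : ℂ) ^ (-s) - (a : ℂ) ^ (-s)‖ ≤ ‖s‖ * (1 / a ^ (s.re + 1)) := by
    intro x hx
    have := norm_image_sub_le_of_norm_deriv_le_segment' (f := fun y : ℝ => (y : ℂ) ^ (-s))
      (f' := fun y : ℝ => -s * (y : ℂ) ^ (-s - 1)) (a := a) (b := a + 1)
      (C := ‖s‖ * (1 / a ^ (s.re + 1)))
      (fun y hy => (hder _ y (by linarith [hy.1])).hasDerivWithinAt) ?_ x hx
    · refine this.trans ?_
      have : x - a ≤ 1 := by linarith [hx.2]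
      exact mul_le_of_le_one_right (by positivity) this
    · intro y hy
      have hy0 : 0 < y := by linarith [hy.1]
      rw [norm_mul, norm_neg, norm_cpow_eq_rpow_re_of_pos hy0]
      gcongr
      rw [show (-s - 1).re = -(s.re + 1) by simp; ring, Real.rpow_neg hy0.le, one_div]
      gcongr
      exact hy.1
  -- The increment over `[a, a + 1]` of this function, whose derivative is
  -- `-(s - 1) (y ^ (-s) - a ^ (-s))`, is the quantity to be estimated.
  have h2 := norm_image_sub_le_of_norm_deriv_le_segment'
    (f := fun y : ℝ => (s - 1) * (a : ℂ) ^ (-s) * (y : ℂ) + (y : ℂ) ^ (1 - s))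
    (f' := fun y : ℝ => (s - 1) * (a : ℂ) ^ (-s) * 1 + (1 - s) * (y : ℂ) ^ (1 - s - 1))
    (a := a) (b := a + 1) (C := ‖s‖ * ‖s - 1‖ * (1 / a ^ (s.re + 1)))
    (fun y hy => (((hasDerivAt_id (y : ℂ)).comp_ofReal.const_mul _).add
      (hder _ y (by linarith [hy.1]))).hasDerivWithinAt) ?_ (a + 1) ⟨by linarith, le_rfl⟩
  · have e : ((n : ℂ) + 1) = (a : ℂ) := by rw [ha]; push_cast; rfl
    rw [e]
    refine (le_of_eq ?_).trans (h2.trans (le_of_eq (by ring)))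
    congr 1
    push_cast
    ring
  · intro y hy
    have e : (s - 1) * (a : ℂ) ^ (-s) * 1 + (1 - s) * (y : ℂ) ^ (1 - s - 1)
        = -((s - 1) * ((y : ℂ) ^ (-s) - (a : ℂ) ^ (-s))) := by
      rw [show 1 - s - 1 = -s by ring]; ring
    rw [e, norm_neg, norm_mul, mul_comm ‖s‖, mul_assoc]
    gcongr
    exact h1 y ⟨hy.1, hy.2.le⟩

/-- Comparison of `∑ n ^ (-s)` with `∫ x ^ (-s)`: for `1 < re s` the second half of the summand
telescopes to `-1`, and both sides are holomorphic for `0 < re s`. -/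
theorem riemannZeta₁_eq_tsum {s : ℂ} (hs : 0 < s.re) :
    riemannZeta₁ s = 1 + ∑' n : ℕ, ((s - 1) * ((n : ℂ) + 1) ^ (-s) +
      (((n : ℂ) + 1 + 1) ^ (1 - s) - ((n : ℂ) + 1) ^ (1 - s))) := by
  set F : ℕ → ℂ → ℂ := fun n s => (s - 1) * ((n : ℂ) + 1) ^ (-s) +
      (((n : ℂ) + 1 + 1) ^ (1 - s) - ((n : ℂ) + 1) ^ (1 - s)) with hF
  have hopen : IsOpen {w : ℂ | 0 < w.re} := isOpen_lt continuous_const continuous_re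
  have hn1 : ∀ n : ℕ, (n : ℂ) + 1 ≠ 0 := fun n => by exact_mod_cast n.succ_ne_zero
  have hn2 : ∀ n : ℕ, (n : ℂ) + 1 + 1 ≠ 0 := fun n => by exact_mod_cast (n + 1).succ_ne_zero
  have hFd : ∀ n, Differentiable ℂ (F n) := by
    intro n w
    refine ((differentiableAt_id.sub_const 1).mul
      (DifferentiableAt.const_cpow (by fun_prop) (Or.inl (hn1 n)))).add
      ((DifferentiableAt.const_cpow (by fun_prop) (Or.inl (hn2 n))).sub
      (DifferentiableAt.const_cpow (by fun_prop) (Or.inl (hn1 n))))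
  have hG : DifferentiableOn ℂ (fun w => 1 + ∑' n, F n w) {w : ℂ | 0 < w.re} := by
    refine DifferentiableOn.const_add _ ?_
    intro w hw
    have hw : 0 < w.re := hw
    set V : Set ℂ := {v : ℂ | w.re / 2 < v.re} ∩ Metric.ball 0 (‖w‖ + 1)
    have hV : IsOpen V := (isOpen_lt continuous_const continuous_re).inter Metric.isOpen_ball
    have hwV : w ∈ V := ⟨by simp; linarith, by simp⟩
    have : DifferentiableOn ℂ (fun w => ∑' n, F n w) V := by
      refine differentiableOn_tsum_of_summable_norm
        (u := fun n : ℕ => ((‖w‖ + 1) * (‖w‖ + 2)) * (1 / ((n : ℝ) + 1) ^ (w.re / 2 + 1)))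
        ((summable_one_div_nat_add_one_rpow (by linarith)).mul_left _)
        (fun n => (hFd n).differentiableOn) hV ?_
      intro n v hv
      have hv1 : w.re / 2 < v.re := hv.1
      have hv2 : ‖v‖ < ‖w‖ + 1 := by simpa using hv.2
      refine (norm_sub_cpow_increment_le v (by linarith) n).trans ?_
      have : ‖v - 1‖ ≤ ‖w‖ + 2 := (norm_sub_le _ _).trans (by rw [norm_one]; linarith)
      gcongr
      linarith [n.cast_nonneg (α := ℝ)]
    exact ((this w hwV).differentiableAt (hV.mem_nhds hwV)).differentiableWithinAt
  have hpre : IsPreconnected {w : ℂ | 0 < w.re} := (convex_halfSpace_re_gt 0).isPreconnected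
  have heq : ∀ w : ℂ, 1 < w.re → riemannZeta₁ w = 1 + ∑' n, F n w := by
    intro w hw
    have hw1 : w ≠ 1 := by rintro rfl; simp at hw
    have hs1 : Summable fun n : ℕ => ((n : ℂ) + 1) ^ (-w) := by
      refine .of_norm_bounded (summable_one_div_nat_add_one_rpow hw) fun n => ?_
      have : ((n : ℂ) + 1) = (((n : ℝ) + 1 : ℝ) : ℂ) := by push_cast; rfl
      rw [this, norm_cpow_eq_rpow_re_of_pos (by positivity), neg_re,
        Real.rpow_neg (by positivity), one_div]
    have hs2 : HasSum (fun n : ℕ => ((n : ℂ) + 1 + 1) ^ (1 - w) - ((n : ℂ) + 1) ^ (1 - w)) (-1) := by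
      have hsF : Summable fun n => F n w :=
        .of_norm_bounded ((summable_one_div_nat_add_one_rpow (s := w.re + 1)
          (by linarith)).mul_left _) fun n => norm_sub_cpow_increment_le w (by linarith) n
      have hsum : Summable fun n : ℕ => ((n : ℂ) + 1 + 1) ^ (1 - w) - ((n : ℂ) + 1) ^ (1 - w) := by
        refine (hsF.sub (hs1.mul_left (w - 1))).congr fun n => ?_
        simp [hF]
      rw [hsum.hasSum_iff_tendsto_nat]
      have ht : Filter.Tendsto (fun n : ℕ => ((n : ℂ) + 1) ^ (1 - w) - 1) Filter.atTop
          (nhds (0 - 1)) := by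
        refine Filter.Tendsto.sub_const ?_ _
        rw [tendsto_zero_iff_norm_tendsto_zero]
        have h := (tendsto_rpow_neg_atTop (y := w.re - 1) (by linarith)).comp
          (Filter.tendsto_atTop_add_const_right _ (1 : ℝ) (tendsto_natCast_atTop_atTop (R := ℝ)))
        refine h.congr fun n => ?_
        have : ((n : ℂ) + 1) = (((n : ℝ) + 1 : ℝ) : ℂ) := by push_cast; rfl
        rw [this, norm_cpow_eq_rpow_re_of_pos (by positivity)]
        simp
      rw [zero_sub] at ht
      refine ht.congr fun N => ?_
      have := Finset.sum_range_sub (fun n : ℕ => ((n : ℂ) + 1) ^ (1 - w)) N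
      push_cast at this
      rw [this]
      simp
    rw [riemannZeta₁_eq_sub_one_mul hw1, zeta_eq_tsum_one_div_nat_add_one_cpow hw, ← tsum_mul_left]
    simp only [hF]
    rw [(hs1.mul_left (w - 1)).tsum_add hs2.summable, hs2.tsum_eq]
    simp only [cpow_neg, one_div]
    ring
  have hA := (differentiable_riemannZeta₁.differentiableOn (s := {w : ℂ | 0 < w.re})).analyticOnNhd
    hopen
  have h2 : (2 : ℂ) ∈ {w : ℂ | 0 < w.re} := by simp
  refine hA.eqOn_of_preconnected_of_eventuallyEq (hG.analyticOnNhd hopen) hpre h2 ?_ hs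
  filter_upwards [(isOpen_lt continuous_const continuous_re).mem_nhds
    (show (2 : ℂ) ∈ {w : ℂ | 1 < w.re} by simp)] with w hw
  exact heq w hw

theorem norm_riemannZeta₁_le {s : ℂ} (hs : 0 < s.re) :
    ‖riemannZeta₁ s‖ ≤ 1 + ‖s‖ * ‖s - 1‖ * (1 + 1 / s.re) := by
  rw [riemannZeta₁_eq_tsum hs]
  refine (norm_add_le _ _).trans ?_
  rw [norm_one]
  gcongr
  have h1 : 1 < s.re + 1 := by linarith
  refine (tsum_of_norm_bounded ((summable_one_div_nat_add_one_rpow h1).mul_left _).hasSum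
    (norm_sub_cpow_increment_le s hs)).trans ?_
  rw [tsum_mul_left]
  gcongr
  simpa using tsum_one_div_nat_add_one_rpow_le h1

/-- The integrand is at most `x ^ (re a - 1) + (1 - x) ^ (-1/2)`. -/
theorem norm_betaIntegral_half_le {a : ℂ} (ha : 0 < a.re) :
    ‖betaIntegral a (1 / 2)‖ ≤ 1 / a.re + 2 := by
  have i1 : IntervalIntegrable (fun x : ℝ => x ^ (a.re - 1)) MeasureTheory.volume 0 1 :=
    intervalIntegral.intervalIntegrable_rpow' (by linarith)
  have i2 : IntervalIntegrable (fun x : ℝ => (1 - x) ^ (-(1 / 2) : ℝ)) MeasureTheory.volume 0 1 := by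
    have := (intervalIntegral.intervalIntegrable_rpow' (a := 0) (b := 1) (r := (-(1 / 2) : ℝ))
      (by norm_num)).comp_sub_left 1
    simpa using this.symm
  have hI : ∫ x in (0 : ℝ)..1, (x ^ (a.re - 1) + (1 - x) ^ (-(1 / 2) : ℝ)) = 1 / a.re + 2 := by
    rw [intervalIntegral.integral_add i1 i2, integral_rpow (Or.inl (by linarith)),
      intervalIntegral.integral_comp_sub_left (fun x : ℝ => x ^ (-(1 / 2) : ℝ)),
      integral_rpow (Or.inl (by norm_num))]
    rw [sub_add_cancel, Real.zero_rpow ha.ne']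
    norm_num
  rw [← hI, betaIntegral]
  refine intervalIntegral.norm_integral_le_of_norm_le zero_le_one ?_ (i1.add i2)
  filter_upwards [MeasureTheory.compl_mem_ae_iff.2 (MeasureTheory.measure_singleton (1 : ℝ))]
    with x hx1 hx
  have hx0 : 0 < x := hx.1
  have hx1 : 0 < 1 - x := sub_pos.2 (lt_of_le_of_ne hx.2 hx1)
  rw [norm_mul, norm_cpow_eq_rpow_re_of_pos hx0,
    show (1 - (x : ℂ)) = ((1 - x : ℝ) : ℂ) by push_cast; rfl, norm_cpow_eq_rpow_re_of_pos hx1,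
    sub_re, one_re, show ((1 / 2 : ℂ) - 1).re = -(1 / 2) by norm_num]
  have e1 : (1 - x) * (1 - x) ^ (-(1 / 2) : ℝ) ≤ 1 := by
    rw [← Real.rpow_one_add' hx1.le (by norm_num)]
    exact Real.rpow_le_one hx1.le (by linarith) (by norm_num)
  have e2 : x ^ (a.re - 1) * x ≤ 1 := by
    rw [← Real.rpow_add_one hx0.ne']
    exact Real.rpow_le_one hx0.le hx.2 (by linarith)
  have p1 : 0 ≤ x ^ (a.re - 1) := by positivity
  have p2 : 0 ≤ (1 - x) ^ (-(1 / 2) : ℝ) := by positivity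
  nlinarith [mul_le_mul_of_nonneg_left e1 p1, mul_le_mul_of_nonneg_right e2 p2]

/-! ### The entire function `ξ` -/

/-- The Riemann `ξ`-function in the normalisation `ξ(s) = s (s - 1) ζ*(s)`, twice the usual one.
It is written through Mathlib's entire function `Λ₀(s) = ζ*(s) + 1 / s + 1 / (1 - s)`, so that it is
entire by construction, with the value `1` at the two poles `0` and `1` of `ζ*`. -/
noncomputable def entireXi (s : ℂ) : ℂ := s * (s - 1) * completedRiemannZeta₀ s + 1

theorem differentiable_entireXi : Differentiable ℂ entireXi := by
  have := differentiable_completedZeta₀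
  unfold entireXi
  fun_prop

theorem entireXi_one_sub (s : ℂ) : entireXi (1 - s) = entireXi s := by
  rw [entireXi, entireXi, completedRiemannZeta₀_one_sub]
  ring

theorem entireXi_eq_mul_completedRiemannZeta {s : ℂ} (h0 : s ≠ 0) (h1 : s ≠ 1) :
    entireXi s = s * (s - 1) * completedRiemannZeta s := by
  have h1' : 1 - s ≠ 0 := sub_ne_zero.2 h1.symm
  rw [entireXi, completedRiemannZeta_eq]
  field_simp
  ring

/-- The factorisation holds at `s = 1` too, because `riemannZeta₁` is `(s - 1) ζ(s)` with its
removable singularity filled in. -/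
theorem entireXi_eq_mul_Gammaℝ_mul_riemannZeta₁ {s : ℂ} (hs : 0 < s.re) :
    entireXi s = s * Gammaℝ s * riemannZeta₁ s := by
  rcases eq_or_ne s 1 with rfl | h1
  · simp [entireXi]
  have h0 : s ≠ 0 := by rintro rfl; simp at hs
  rw [entireXi_eq_mul_completedRiemannZeta h0 h1, riemannZeta₁_eq_sub_one_mul h1, riemannZeta_def_of_ne_zero h0]
  have := Gammaℝ_ne_zero_of_re_pos hs
  field_simp

theorem entireXi_ne_zero {s : ℂ} (hs : 1 ≤ s.re) : entireXi s ≠ 0 := by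
  have hs0 : 0 < s.re := by linarith
  have h0 : s ≠ 0 := by rintro rfl; simp at hs0
  rw [entireXi_eq_mul_Gammaℝ_mul_riemannZeta₁ hs0]
  refine mul_ne_zero (mul_ne_zero h0 (Gammaℝ_ne_zero_of_re_pos hs0)) ?_
  rcases eq_or_ne s 1 with rfl | h1
  · simp
  · have := riemannZeta_ne_zero_of_one_le_re hs
    rw [riemannZeta_eq_inv_sub_mul h1] at this
    exact right_ne_zero_of_mul this

theorem entireXi_conj {s : ℂ} (hs : 0 < s.re) :
    entireXi (starRingEnd ℂ s) = starRingEnd ℂ (entireXi s) := by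
  rcases eq_or_ne s 1 with rfl | h1
  · simp [entireXi]
  have hs' : 0 < (starRingEnd ℂ s).re := by simpa using hs
  have h1' : starRingEnd ℂ s ≠ 1 := fun h => h1 (by simpa using congrArg (starRingEnd ℂ) h)
  have e : Gammaℝ (starRingEnd ℂ s) = starRingEnd ℂ (Gammaℝ s) := by
    rw [Gammaℝ_def, Gammaℝ_def, map_mul, ← Gamma_conj, cpow_def_of_ne_zero (by simp),
      cpow_def_of_ne_zero (by simp), ← exp_conj, ← ofReal_log Real.pi_pos.le]
    simp [map_ofNat]
  rw [entireXi_eq_mul_Gammaℝ_mul_riemannZeta₁ hs, entireXi_eq_mul_Gammaℝ_mul_riemannZeta₁ hs',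
    riemannZeta₁_eq_sub_one_mul h1, riemannZeta₁_eq_sub_one_mul h1', riemannZeta_conj, e]
  simp

/-! ### The strict inequality `|ξ(z)| < |ξ(z + 1)|` for `0 < re z` -/

/-- The Gamma factors of `ξ(z) / ξ(z + 1)` form a beta integral, because `Γ(1/2) = √π`. -/
theorem Gammaℝ_div_Gammaℝ_add_one {z : ℂ} (hz : 0 < z.re) :
    Gammaℝ z / Gammaℝ (z + 1) = betaIntegral (z / 2) (1 / 2) := by
  have h2 : 0 < (z / 2).re := by simpa using hz
  have hB := Gamma_mul_Gamma_eq_betaIntegral h2 (show 0 < (1 / 2 : ℂ).re by norm_num)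
  have hpi : (Real.pi : ℂ) ≠ 0 := by exact_mod_cast Real.pi_ne_zero
  have hG : Gamma ((z + 1) / 2) ≠ 0 := Gamma_ne_zero_of_re_pos (by simp; linarith)
  have hp : (Real.pi : ℂ) ^ (-(z + 1) / 2) ≠ 0 := by simp [cpow_eq_zero_iff, hpi]
  have e : (Real.pi : ℂ) ^ (-z / 2) = Real.pi ^ (-(z + 1) / 2) * Real.pi ^ (1 / 2 : ℂ) := by
    rw [← cpow_add _ _ hpi]; congr 1; ring
  rw [Gammaℝ_def, Gammaℝ_def, e, div_eq_iff (mul_ne_zero hp hG)]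
  rw [Gamma_one_half_eq, show z / 2 + 1 / 2 = (z + 1) / 2 by ring] at hB
  linear_combination (Real.pi : ℂ) ^ (-(z + 1) / 2) * hB

/-- A polynomial bound in the open right half-plane that degenerates only like `(re z)⁻³` at its
boundary: `ζ₁(z)`, the beta integral and `1 / ζ(z + 1)` each contribute one factor `1 + 1 / re z`. -/
theorem norm_entireXi_div_le {z : ℂ} (hz : 0 < z.re) :
    ‖entireXi z / entireXi (z + 1)‖ ≤ 2 * (1 + 1 / z.re) ^ 3 * (1 + ‖z‖) ^ 2 := by
  have hz1 : 1 < (z + 1).re := by simpa using hz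
  have hz0 : z ≠ 0 := by rintro rfl; simp at hz
  have hz10 : z + 1 ≠ 0 := fun h => by rw [h] at hz1; simp at hz1; linarith
  have e : entireXi z / entireXi (z + 1) = riemannZeta₁ z * betaIntegral (z / 2) (1 / 2) *
      (riemannZeta (z + 1))⁻¹ * (z + 1)⁻¹ := by
    rw [entireXi_eq_mul_Gammaℝ_mul_riemannZeta₁ hz,
      entireXi_eq_mul_Gammaℝ_mul_riemannZeta₁ (by linarith), ← Gammaℝ_div_Gammaℝ_add_one hz,
      riemannZeta_eq_inv_sub_mul (s := z + 1) (by simpa using hz0)]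
    rw [add_sub_cancel_right]
    field_simp
  have b1 := norm_riemannZeta₁_le hz
  have b2 := norm_betaIntegral_half_le (a := z / 2) (by simpa using hz)
  have b3 := norm_inv_riemannZeta_le hz1
  have b4 : ‖(z + 1)⁻¹‖ ≤ 1 := by
    rw [norm_inv]
    exact inv_le_one_of_one_le₀ (hz1.le.trans (re_le_norm _))
  have b5 : ‖z - 1‖ ≤ 1 + ‖z‖ := (norm_sub_le _ _).trans (by rw [norm_one, add_comm])
  have hx : 0 ≤ 1 / z.re := by positivity
  rw [e]
  simp only [norm_mul]
  calc _ ≤ ((1 + 1 / z.re) * (1 + ‖z‖) ^ 2) * (2 * (1 + 1 / z.re)) * (1 + 1 / z.re) * 1 := by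
        gcongr
        · refine b1.trans ?_
          have := norm_nonneg z
          have : ‖z‖ * ‖z - 1‖ * (1 + 1 / z.re) ≤ ‖z‖ * (1 + ‖z‖) * (1 + 1 / z.re) := by gcongr
          nlinarith
        · refine b2.trans (le_of_eq ?_)
          rw [show (z / 2).re = z.re / 2 by simp]
          field_simp
          ring
        · refine b3.trans (le_of_eq ?_)
          simp
    _ = _ := by ring

/-- On the line `re z = 0` the functional equation and the reality of `ξ` make `ξ(z)` and
`ξ(z + 1)` complex conjugates, so the quotient has modulus `1` there. The maximum principle then
bounds it by `1` on the half-plane, and strictly so because it is not of constant modulus. -/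
theorem norm_entireXi_lt {z : ℂ} (hz : 0 < z.re) : ‖entireXi z‖ < ‖entireXi (z + 1)‖ := by
  set Q : ℂ → ℂ := fun z => entireXi z / entireXi (z + 1) with hQ
  have hne : ∀ w : ℂ, 0 ≤ w.re → entireXi (w + 1) ≠ 0 := fun w hw =>
    entireXi_ne_zero (by simpa using hw)
  have hd : DifferentiableOn ℂ Q {z | 0 ≤ z.re} := by
    refine DifferentiableOn.div differentiable_entireXi.differentiableOn
      (differentiable_entireXi.comp (by fun_prop)).differentiableOn fun w hw => hne w hw
  have hb : ∀ w : ℂ, w.re = 0 → ‖Q w‖ ≤ 1 := by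
    intro w hw
    have h1 : entireXi w = starRingEnd ℂ (entireXi (w + 1)) := by
      rw [← entireXi_conj (by simp [hw]), ← entireXi_one_sub]
      congr 1
      apply Complex.ext <;> simp [hw]
    rw [hQ]
    simp only [norm_div, h1, RCLike.norm_conj]
    exact div_self_le_one _
  have hle : ∀ w : ℂ, 0 < w.re → ‖Q w‖ ≤ 1 := fun w hw =>
    norm_le_one_of_boundary_growth hd zero_le_two hb (fun w hw => norm_entireXi_div_le hw) hw
  have hlt : ‖Q z‖ < 1 := by
    refine lt_of_le_of_ne (hle z hz) fun h => ?_
    have hmax : IsMaxOn (norm ∘ Q) {w : ℂ | 0 < w.re} z := fun w hw => by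
      simpa [h] using hle w hw
    -- Otherwise the quotient has modulus `1` throughout, but at `1` it is `ξ(1) / ξ(2) = 3 / π`.
    have h1 := norm_eqOn_of_isPreconnected_of_isMaxOn (convex_halfSpace_re_gt 0).isPreconnected
      (isOpen_lt continuous_const continuous_re)
      (hd.mono fun w (hw : 0 < w.re) => hw.le) hz hmax (show (1 : ℂ) ∈ {w : ℂ | 0 < w.re} by simp)
    have e1 : entireXi 1 = 1 := by simp [entireXi]
    have e2 : entireXi (1 + 1) = (Real.pi / 3 : ℝ) := by
      have hG : Gammaℝ 2 = (Real.pi : ℂ)⁻¹ := by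
        rw [Gammaℝ_def]; simp [cpow_neg]
      rw [show (1 + 1 : ℂ) = 2 by norm_num, entireXi_eq_mul_Gammaℝ_mul_riemannZeta₁ (by simp), hG]
      have : riemannZeta₁ 2 = riemannZeta 2 := by
        rw [riemannZeta₁_eq_sub_one_mul (by norm_num)]; norm_num
      have hpi : (Real.pi : ℂ) ≠ 0 := by exact_mod_cast Real.pi_ne_zero
      rw [this, riemannZeta_two]
      push_cast
      field_simp
      norm_num
    have h3 := Real.pi_gt_three
    simp only [Function.comp, hQ, Function.const, e1, e2, norm_div (α := ℂ), norm_one, norm_real]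
      at h1
    have h4 : ‖Real.pi / 3‖ = Real.pi / 3 := Real.norm_of_nonneg (by positivity)
    have h5 : ‖entireXi z‖ / ‖entireXi (z + 1)‖ = 1 := by rw [← norm_div]; exact h
    rw [h4, h5, div_eq_one_iff_eq (by positivity)] at h1
    linarith
  rw [hQ] at hlt
  simp only [norm_div] at hlt
  rwa [div_lt_one (norm_pos_iff.2 (hne z hz.le))] at hlt

/-! ### The function `I(T, s)` in terms of `ξ` -/

theorem meromorphicAt_truncI {T : ℝ} (hT : 0 < T) (z : ℂ) : MeromorphicAt (truncI T) z := by
  have hTc : (T : ℂ) ≠ 0 := by exact_mod_cast hT.ne'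
  have hrep : truncI T = fun s =>
      -(completedRiemannZeta₀ (2 * s) - 1 / (2 * s) - 1 / (1 - 2 * s)) *
        ((T : ℂ) ^ (s - 1) / (s - 1)) +
      (completedRiemannZeta₀ (2 - 2 * s) - 1 / (2 - 2 * s) - 1 / (1 - (2 - 2 * s))) *
        ((T : ℂ) ^ (-s) / s) := by
    funext s
    rw [truncI, completedRiemannZeta_eq, completedRiemannZeta_eq]
  have a1 : MeromorphicAt (fun s : ℂ => completedRiemannZeta₀ (2 * s)) z :=
    ((differentiable_completedZeta₀.comp (by fun_prop : Differentiable ℂ fun s : ℂ => 2 * s)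
      ).analyticAt z).meromorphicAt
  have a2 : MeromorphicAt (fun s : ℂ => completedRiemannZeta₀ (2 - 2 * s)) z :=
    ((differentiable_completedZeta₀.comp (by fun_prop : Differentiable ℂ fun s : ℂ => 2 - 2 * s)
      ).analyticAt z).meromorphicAt
  have a3 : MeromorphicAt (fun s : ℂ => (T : ℂ) ^ (s - 1)) z :=
    (Differentiable.analyticAt (fun w => DifferentiableAt.const_cpow (by fun_prop) (Or.inl hTc))
      z).meromorphicAt
  have a4 : MeromorphicAt (fun s : ℂ => (T : ℂ) ^ (-s)) z :=
    (Differentiable.analyticAt (fun w => DifferentiableAt.const_cpow (by fun_prop) (Or.inl hTc))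
      z).meromorphicAt
  rw [hrep]
  fun_prop

/-- Multiplying by the three linear factors clears all poles of `I(T, s)` and leaves an entire
function that changes sign under `s ↦ 1 - s`. -/
theorem mul_truncI_eq (T : ℝ) {s : ℂ} (h0 : s ≠ 0) (h1 : s ≠ 1) (h2 : s ≠ 1 / 2) :
    2 * s * (s - 1) * (2 * s - 1) * truncI T s =
      entireXi (2 - 2 * s) * (T : ℂ) ^ (-s) - entireXi (2 * s) * (T : ℂ) ^ (s - 1) := by
  have hs1 : s - 1 ≠ 0 := sub_ne_zero.2 h1
  rw [entireXi_eq_mul_completedRiemannZeta (s := 2 * s) (by simpa using h0)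
      (fun h => h2 (by linear_combination h / 2)),
    entireXi_eq_mul_completedRiemannZeta (s := 2 - 2 * s)
      (fun h => h1 (by linear_combination -h / 2)) (fun h => h2 (by linear_combination -h / 2)),
    truncI]
  field_simp
  ring

/-- Since `I(T, ·)` tends to `0` along the punctured neighbourhoods of a zero, so does the entire
function of `mul_truncI_eq`, which therefore vanishes there; this holds at `0`, `1/2` and `1` as
well. -/
theorem entireXi_mul_cpow_eq_of_isMeromorphicZero {T : ℝ} (hT : 0 < T) {ρ : ℂ}
    (hρ : IsMeromorphicZero (truncI T) ρ) :
    entireXi (2 - 2 * ρ) * (T : ℂ) ^ (-ρ) = entireXi (2 * ρ) * (T : ℂ) ^ (ρ - 1) := by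
  have hTc : (T : ℂ) ≠ 0 := by exact_mod_cast hT.ne'
  have hξ := differentiable_entireXi.continuous
  have hc1 : Continuous fun s : ℂ => (T : ℂ) ^ (-s) :=
    continuous_neg.const_cpow (Or.inl hTc)
  have hc2 : Continuous fun s : ℂ => (T : ℂ) ^ (s - 1) :=
    (continuous_sub_right 1).const_cpow (Or.inl hTc)
  have hG : Continuous fun s : ℂ =>
      entireXi (2 - 2 * s) * (T : ℂ) ^ (-s) - entireXi (2 * s) * (T : ℂ) ^ (s - 1) := by
    fun_prop
  have hp : Continuous fun s : ℂ => 2 * s * (s - 1) * (2 * s - 1) := by fun_prop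
  have t1 := ((hp.tendsto ρ).mono_left (nhdsWithin_le_nhds (s := {ρ}ᶜ))).mul
    (tendsto_zero_of_meromorphicOrderAt_pos hρ.2)
  have t2 := (hG.tendsto ρ).mono_left (nhdsWithin_le_nhds (s := {ρ}ᶜ))
  have hev : ∀ᶠ s in nhdsWithin ρ {ρ}ᶜ, 2 * s * (s - 1) * (2 * s - 1) * truncI T s =
      entireXi (2 - 2 * s) * (T : ℂ) ^ (-s) - entireXi (2 * s) * (T : ℂ) ^ (s - 1) := by
    have hfin : ({0, 1, 1 / 2} \ {ρ} : Set ℂ).Finite := (Set.toFinite _).sdiff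
    filter_upwards [nhdsWithin_le_nhds (hfin.isClosed.isOpen_compl.mem_nhds
      (show ρ ∈ ({0, 1, 1 / 2} \ {ρ} : Set ℂ)ᶜ by simp)), self_mem_nhdsWithin] with s hs hsρ
    have hs' : s ∉ ({0, 1, 1 / 2} : Set ℂ) := fun h => hs ⟨h, hsρ⟩
    simp only [Set.mem_insert_iff, Set.mem_singleton_iff, not_or] at hs'
    exact mul_truncI_eq T hs'.1 hs'.2.1 hs'.2.2
  have := tendsto_nhds_unique (t1.congr' hev) t2
  rw [mul_zero] at this
  exact (sub_eq_zero.1 this.symm)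

theorem theorem1p2 (T : ℝ) (hT : 1 ≤ T) :
    (∀ z : ℂ, MeromorphicAt (truncI T) z) ∧
      ∀ ρ : ℂ, IsMeromorphicZero (truncI T) ρ → ρ.re = 1 / 2 := by
  have hT0 : 0 < T := by linarith
  refine ⟨meromorphicAt_truncI hT0, fun ρ hρ => ?_⟩
  have h := congrArg norm (entireXi_mul_cpow_eq_of_isMeromorphicZero hT0 hρ)
  rw [norm_mul, norm_mul, norm_cpow_eq_rpow_re_of_pos hT0, norm_cpow_eq_rpow_re_of_pos hT0] at h
  rcases lt_trichotomy ρ.re (1 / 2) with hlt | heq | hgt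
  -- Left of the line, `|ξ(2ρ)| < |ξ(2 - 2ρ)|` and the power of `T ≥ 1` favours the same term.
  · have hz : 0 < (1 - 2 * ρ).re := by simp; linarith
    have hX := norm_entireXi_lt hz
    rw [entireXi_one_sub, show 1 - 2 * ρ + 1 = 2 - 2 * ρ by ring] at hX
    have hp : T ^ (ρ - 1).re ≤ T ^ (-ρ).re :=
      Real.rpow_le_rpow_of_exponent_le hT (by simp; linarith)
    exact absurd h.symm (mul_lt_mul hX hp (by positivity) (norm_nonneg _)).ne
  · exact heq
  · have hz : 0 < (2 * ρ - 1).re := by simp; linarith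
    have hX := norm_entireXi_lt hz
    rw [← entireXi_one_sub, show 1 - (2 * ρ - 1) = 2 - 2 * ρ by ring, sub_add_cancel] at hX
    have hp : T ^ (-ρ).re ≤ T ^ (ρ - 1).re :=
      Real.rpow_le_rpow_of_exponent_le hT (by simp; linarith)
    exact absurd h (mul_lt_mul hX hp (by positivity) (norm_nonneg _)).ne
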